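/- Let $E$ be a (real) Banach lattice and let $F$ be an AM-space, i.e. a (real) Banach lattice with $\|x\vee y\|=\max\{\|x\|,\|y\|\}$ for all $x,y\ge 0$ in $F$. A (not necessarily linear) map $T:E\to F$ is called orthogonally additive if $T(x+y)=Tx+Ty$ whenever $|x|\wedge|y|=0$, and compact if it maps every norm bounded subset of $E$ to a relatively compact subset of $F$. The vector space of all orthogonally additive operators from $E$ to $F$ is ordered by $S\le T$ if and only if $Sx\le Tx$ for all $x\in E$. If $T:E\to F$ is a compact orthogonally additive operator, then its modulus $|T|=T\vee(-T)$, i.e. the least upper bound of $T$ and $-T$ in the ordered vector space of all orthogonally additive operators from $E$ to $F$, exists, and $|T|$ is itself compact. -/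

import Mathlib

/-- Two elements `x`, `y` of a vector lattice are disjoint, `x ⊥ y`, if `|x| ∧ |y| = 0`. -/
def LatticeDisjoint {E : Type*} [Lattice E] [AddCommGroup E] (x y : E) : Prop :=
  |x| ⊓ |y| = 0

/-- The space of all orthogonally additive operators `T : E → F`, that is, of the (not necessarily
linear) maps with `T (x + y) = T x + T y` for all disjoint `x`, `y`.  The operations are pointwise.
If `F` is ordered, the order is the pointwise one: `S ≤ T` iff `S x ≤ T x` for every `x : E`, i.e.
iff `T - S` is a positive operator. -/
def OrthogonallyAdditive (E F : Type*) [Lattice E] [AddCommGroup E] [AddCommGroup F] [Module ℝ F] :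
    Submodule ℝ (E → F) where
  carrier := {T | ∀ x y : E, LatticeDisjoint x y → T (x + y) = T x + T y}
  zero_mem' := by
    intro x y _
    simp
  add_mem' := by
    intro S T hS hT x y h
    simp only [Pi.add_apply, hS x y h, hT x y h]
    abel
  smul_mem' := by
    intro c T hT x y h
    simp only [Pi.smul_apply, hT x y h, smul_add]

/-- `R` is the modulus `|T| = T ∨ (-T)` of `T`: the least upper bound of `T` and `-T` in the ordered
vector space of orthogonally additive operators. -/
def IsModulus {E F : Type*} [Lattice E] [AddCommGroup E] [Lattice F] [AddCommGroup F] [Module ℝ F]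
    (T R : OrthogonallyAdditive E F) : Prop :=
  IsLUB {T, -T} R

/-- A (nonlinear) operator between normed spaces is compact if it maps norm bounded sets to
relatively compact sets. -/
def MapsBoundedToRelCompact {E F : Type*} [NormedAddCommGroup E] [NormedAddCommGroup F]
    (T : E → F) : Prop :=
  ∀ B : Set E, Bornology.IsBounded B → IsCompact (closure (T '' B))

/-- The norm of a normed lattice is an M-norm: `‖x ∨ y‖ = max ‖x‖ ‖y‖` for positive `x`, `y`.
A Banach lattice with an M-norm is an AM-space. -/
def IsMNorm (F : Type*) [NormedAddCommGroup F] [Lattice F] : Prop :=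
  ∀ x y : F, 0 ≤ x → 0 ≤ y → ‖x ⊔ y‖ = max ‖x‖ ‖y‖

/-!
The modulus of `T` is given by `R x = sup {T y - T z | y + z = x, y ⊥ z}`.

These suprema exist because in an AM-space the supremum of a finite set is 1-Lipschitz for the
Hausdorff distance (`IsMNorm.norm_sup'_sub_sup'_le`). Hence the suprema of the finite subsets of a
totally bounded set form a Cauchy net, whose limit is the supremum of the whole set
(`IsMNorm.exists_isLUB_of_totallyBounded`). By the same estimate, all suprema of subsets of a
totally bounded set are approximated by the finitely many suprema of subsets of a finite net
(`IsMNorm.totallyBounded_setOf_isLUB`). If `y + z = x` with `y ⊥ z`, then `|y|, |z| ≤ |x|`; so, for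
`x` in a bounded set, all the differences `T y - T z` lie in one totally bounded set
(`MapsBoundedToRelCompact.exists_totallyBounded`). This gives both the existence of `R` and its
compactness.

Two disjoint decompositions of an element have a common disjoint refinement
(`LatticeDisjoint.exists_refinement`). Thus, for disjoint `x₁`, `x₂`, the set defining `R (x₁ + x₂)`
is the sum of those defining `R x₁` and `R x₂`, which makes `R` orthogonally additive. An
orthogonally additive `S ≥ ±T` satisfies `S x = S y + S z ≥ T y - T z`, so `R` is least.
-/

/-! ### Suprema in AM-spaces -/

section MNorm

variable {F : Type*} [NormedAddCommGroup F] [Lattice F] [IsOrderedAddMonoid F] [HasSolidNorm F]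

/-- The error `u` is the supremum of the finitely many `|a - b|` with `b` close to `a`; its norm is
at most `ε`, not just a multiple of it, because the norm is an M-norm. -/
theorem IsMNorm.exists_sup'_le_add (hF : IsMNorm F) {s t : Finset F} (hs : s.Nonempty)
    (ht : t.Nonempty) {ε : ℝ} (h : ∀ a ∈ s, ∃ b ∈ t, ‖a - b‖ ≤ ε) :
    ∃ u : F, 0 ≤ u ∧ ‖u‖ ≤ ε ∧ s.sup' hs id ≤ t.sup' ht id + u := by
  choose! b hbt hb using h
  have key : 0 ≤ s.sup' hs (fun a => |a - b a|) ∧ ‖s.sup' hs (fun a => |a - b a|)‖ ≤ ε := by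
    refine Finset.sup'_induction (p := fun x => 0 ≤ x ∧ ‖x‖ ≤ ε) hs _ ?_ ?_
    · rintro x ⟨hx, hx'⟩ y ⟨hy, hy'⟩
      exact ⟨hx.trans le_sup_left, by rw [hF x y hx hy]; exact max_le hx' hy'⟩
    · intro a ha
      exact ⟨abs_nonneg _, by rw [norm_abs_eq_norm]; exact hb a ha⟩
  refine ⟨_, key.1, key.2, Finset.sup'_le _ _ fun a ha => ?_⟩
  calc id a = b a + (a - b a) := by simp
    _ ≤ b a + |a - b a| := by gcongr; exact le_abs_self _
    _ ≤ _ := add_le_add (Finset.le_sup' id (hbt a ha))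
      (Finset.le_sup' (fun a => |a - b a|) ha)

/-- In an AM-space, the supremum of a finite set is 1-Lipschitz for the Hausdorff distance. -/
theorem IsMNorm.norm_sup'_sub_sup'_le (hF : IsMNorm F) {s t : Finset F} (hs : s.Nonempty)
    (ht : t.Nonempty) {ε : ℝ} (hst : ∀ a ∈ s, ∃ b ∈ t, ‖a - b‖ ≤ ε)
    (hts : ∀ b ∈ t, ∃ a ∈ s, ‖a - b‖ ≤ ε) :
    ‖s.sup' hs id - t.sup' ht id‖ ≤ ε := by
  obtain ⟨u, hu, hu', hu''⟩ := hF.exists_sup'_le_add hs ht hst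
  obtain ⟨v, hv, hv', hv''⟩ := hF.exists_sup'_le_add ht hs
    (fun b hb => by simpa only [norm_sub_rev b] using hts b hb)
  have h : |s.sup' hs id - t.sup' ht id| ≤ u ⊔ v := by
    refine abs_le'.2 ⟨?_, ?_⟩
    · exact (sub_le_iff_le_add'.2 hu'').trans le_sup_left
    · rw [neg_sub]
      exact (sub_le_iff_le_add'.2 hv'').trans le_sup_right
  calc ‖s.sup' hs id - t.sup' ht id‖ ≤ ‖u ⊔ v‖ :=
        norm_le_norm_of_abs_le_abs (h.trans (le_abs_self _))
    _ ≤ ε := by rw [hF u v hu hv]; exact max_le hu' hv'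

/-- A nonempty totally bounded set `A` in an AM-space has a supremum: the limit of the suprema of
its finite subsets. The second clause passes the Lipschitz estimate to that limit. -/
theorem IsMNorm.exists_isLUB_of_totallyBounded [CompleteSpace F] (hF : IsMNorm F) {A : Set F}
    (hA : TotallyBounded A) (hne : A.Nonempty) :
    ∃ x, IsLUB A x ∧ ∀ (ε : ℝ) (t : Finset F) (ht : t.Nonempty),
      (∀ a ∈ A, ∃ b ∈ t, ‖a - b‖ ≤ ε) → (∀ b ∈ t, ∃ a ∈ A, ‖a - b‖ ≤ ε) →
        ‖x - t.sup' ht id‖ ≤ ε := by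
  classical
  obtain ⟨a₀, ha₀⟩ := hne
  -- The point `a₀` is adjoined to make every finite subset nonempty.
  let S : Finset A → Finset F := fun s => insert a₀ (s.image Subtype.val)
  have hSne : ∀ s, (S s).Nonempty := fun s => Finset.insert_nonempty _ _
  have hSA : ∀ s, ∀ a ∈ S s, a ∈ A := by
    intro s a ha
    rcases Finset.mem_insert.1 ha with rfl | ha
    · exact ha₀
    · obtain ⟨c, -, rfl⟩ := Finset.mem_image.1 ha
      exact c.2
  let g : Finset A → F := fun s => (S s).sup' (hSne s) id
  have hmono : Monotone g := fun s s' h =>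
    Finset.sup'_mono _ (Finset.insert_subset_insert _ (Finset.image_subset_image h)) _
  have hclose : ∀ (ε : ℝ) (t : Finset F) (ht : t.Nonempty),
      (∀ a ∈ A, ∃ b ∈ t, ‖a - b‖ ≤ ε) → (∀ b ∈ t, ∃ a ∈ A, ‖a - b‖ ≤ ε) →
        ∀ᶠ s in Filter.atTop, ‖g s - t.sup' ht id‖ ≤ ε := by
    intro ε t ht hAt htA
    choose c hcA hc using htA
    filter_upwards [Filter.eventually_ge_atTop
      (t.attach.image fun b : t => (⟨c b b.2, hcA b b.2⟩ : A))] with s hs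
    refine hF.norm_sup'_sub_sup'_le _ _ (fun a ha => hAt a (hSA s a ha)) fun b hb =>
      ⟨c b hb, ?_, hc b hb⟩
    refine Finset.mem_insert_of_mem (Finset.mem_image.2 ⟨⟨c b hb, hcA b hb⟩, hs ?_, rfl⟩)
    exact Finset.mem_image.2 ⟨⟨b, hb⟩, Finset.mem_attach _ _, rfl⟩
  have hcauchy : Cauchy (Filter.map g Filter.atTop) := by
    refine Metric.cauchy_iff.2 ⟨inferInstance, fun ε hε => ?_⟩
    obtain ⟨N, hNA, hNfin, hN⟩ := Metric.finite_approx_of_totallyBounded hA (ε / 3) (by positivity)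
    have hN' : ∀ a ∈ A, ∃ b ∈ hNfin.toFinset, ‖a - b‖ ≤ ε / 3 := by
      intro a ha
      obtain ⟨b, hb, hab⟩ := Set.mem_iUnion₂.1 (hN ha)
      exact ⟨b, hNfin.mem_toFinset.2 hb, by rw [← dist_eq_norm]; exact (Metric.mem_ball.1 hab).le⟩
    have hNne : hNfin.toFinset.Nonempty := let ⟨b, hb, _⟩ := hN' a₀ ha₀; ⟨b, hb⟩
    refine ⟨_, Filter.image_mem_map (hclose (ε / 3) _ hNne hN' fun b hb =>
      ⟨b, hNA (hNfin.mem_toFinset.1 hb), by simp; positivity⟩), ?_⟩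
    rintro _ ⟨s, hs, rfl⟩ _ ⟨s', hs', rfl⟩
    simp only [Set.mem_ofPred_eq, ← dist_eq_norm] at hs hs'
    linarith [dist_triangle_right (g s) (g s') (hNfin.toFinset.sup' hNne id)]
  obtain ⟨x, hx⟩ := CompleteSpace.complete hcauchy
  have hx : Filter.Tendsto g Filter.atTop (nhds x) := hx
  refine ⟨x, ⟨fun a ha => ?_, fun y hy => ?_⟩, fun ε t ht h₁ h₂ => ?_⟩
  · refine le_trans ?_ (hmono.ge_of_tendsto hx {⟨a, ha⟩})
    exact Finset.le_sup' id (by simp [S])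
  · exact le_of_tendsto' hx fun s => Finset.sup'_le _ _ fun a ha => hy (hSA s a ha)
  · exact le_of_tendsto (hx.sub_const _).norm (hclose ε t ht h₁ h₂)

/-- In an AM-space, the suprema of the nonempty subsets of a totally bounded set `G` form a totally
bounded set: up to `ε`, each of them is the supremum of a subset of a finite `ε`-net of `G`. -/
theorem IsMNorm.totallyBounded_setOf_isLUB [CompleteSpace F] (hF : IsMNorm F) {G : Set F}
    (hG : TotallyBounded G) :
    TotallyBounded {x : F | ∃ A ⊆ G, A.Nonempty ∧ IsLUB A x} := by
  classical
  refine Metric.totallyBounded_iff.2 fun ε hε => ?_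
  obtain ⟨N, -, hNfin, hN⟩ := Metric.finite_approx_of_totallyBounded hG (ε / 2) (by positivity)
  refine ⟨⋃ M ∈ hNfin.toFinset.powerset, {y | IsLUB (M : Set F) y},
    Finset.finite_toSet _ |>.biUnion fun M _ =>
      Set.Subsingleton.finite fun y hy z hz => hy.unique hz, ?_⟩
  rintro x ⟨A, hAG, hAne, hx⟩
  obtain ⟨x', hx', hclose⟩ := hF.exists_isLUB_of_totallyBounded (hG.subset hAG) hAne
  obtain rfl := hx.unique hx'
  let M : Finset F := hNfin.toFinset.filter fun b => ∃ a ∈ A, ‖a - b‖ ≤ ε / 2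
  have hAM : ∀ a ∈ A, ∃ b ∈ M, ‖a - b‖ ≤ ε / 2 := by
    intro a ha
    obtain ⟨b, hb, hab⟩ := Set.mem_iUnion₂.1 (hN (hAG ha))
    have hab' : ‖a - b‖ ≤ ε / 2 := by rw [← dist_eq_norm]; exact (Metric.mem_ball.1 hab).le
    exact ⟨b, Finset.mem_filter.2 ⟨hNfin.mem_toFinset.2 hb, a, ha, hab'⟩, hab'⟩
  have hMne : M.Nonempty := let ⟨a, ha⟩ := hAne; let ⟨b, hb, _⟩ := hAM a ha; ⟨b, hb⟩
  refine Set.mem_iUnion₂.2 ⟨M.sup' hMne id, Set.mem_iUnion₂.2 ⟨M,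
    Finset.mem_powerset.2 (Finset.filter_subset _ _), ?_⟩, ?_⟩
  · exact ⟨fun b hb => Finset.le_sup' id hb, fun y hy => Finset.sup'_le _ _ fun b hb => hy hb⟩
  · rw [Metric.mem_ball, dist_eq_norm]
    exact (hclose (ε / 2) M hMne hAM fun b hb => (Finset.mem_filter.1 hb).2).trans_lt
      (half_lt_self hε)

end MNorm

/-! ### Disjoint decompositions in vector lattices -/

section Disjointness

variable {E : Type*} [AddCommGroup E] [Lattice E]

theorem LatticeDisjoint.symm {x y : E} (h : LatticeDisjoint x y) : LatticeDisjoint y x := by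
  rwa [LatticeDisjoint, inf_comm]

theorem LatticeDisjoint.neg {x y : E} (h : LatticeDisjoint x y) : LatticeDisjoint (-x) (-y) := by
  simpa only [LatticeDisjoint, abs_neg] using h

/-- The common part of `y` and `x`, formed separately on the positive and the negative parts. When
both are fragments of one element, this is their meet in its Boolean algebra of fragments. -/
def commonPart (y x : E) : E := y⁺ ⊓ x⁺ - y⁻ ⊓ x⁻

theorem commonPart_comm (y x : E) : commonPart y x = commonPart x y := by
  rw [commonPart, commonPart, inf_comm, inf_comm y⁻]

variable [IsOrderedAddMonoid E]

theorem LatticeDisjoint.mono {x y x' y' : E} (h : LatticeDisjoint x y) (hx : |x'| ≤ |x|)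
    (hy : |y'| ≤ |y|) : LatticeDisjoint x' y' :=
  le_antisymm ((inf_le_inf hx hy).trans h.le) (le_inf (abs_nonneg _) (abs_nonneg _))

theorem latticeDisjoint_zero_right (x : E) : LatticeDisjoint x 0 := by
  simp [LatticeDisjoint]

theorem inf_add_le_inf_add_inf {a b c : E} (ha : 0 ≤ a) (hb : 0 ≤ b) (hc : 0 ≤ c) :
    a ⊓ (b + c) ≤ a ⊓ b + a ⊓ c := by
  rw [add_inf, inf_add, inf_add]
  refine le_inf (le_inf ?_ ?_) (le_inf ?_ ?_)
  · exact inf_le_left.trans (le_add_of_nonneg_left ha)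
  · exact inf_le_left.trans (le_add_of_nonneg_left hb)
  · exact inf_le_left.trans (le_add_of_nonneg_right hc)
  · exact inf_le_right

theorem LatticeDisjoint.add_right {x y z : E} (hy : LatticeDisjoint x y)
    (hz : LatticeDisjoint x z) : LatticeDisjoint x (y + z) := by
  refine le_antisymm ?_ (le_inf (abs_nonneg _) (abs_nonneg _))
  calc |x| ⊓ |y + z| ≤ |x| ⊓ (|y| + |z|) := inf_le_inf_left _ (abs_add_le _ _)
    _ ≤ |x| ⊓ |y| + |x| ⊓ |z| :=
      inf_add_le_inf_add_inf (abs_nonneg _) (abs_nonneg _) (abs_nonneg _)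
    _ = 0 := by rw [hy, hz, add_zero]

theorem LatticeDisjoint.add_left {x y z : E} (hy : LatticeDisjoint y x)
    (hz : LatticeDisjoint z x) : LatticeDisjoint (y + z) x :=
  (hy.symm.add_right hz.symm).symm

theorem add_eq_sup_of_inf_eq_zero {b c : E} (h : b ⊓ c = 0) : b + c = b ⊔ c := by
  rw [← inf_add_sup, h, zero_add]

theorem inf_add_eq_of_inf_eq_zero {a b c : E} (ha : 0 ≤ a) (h : b ⊓ c = 0) :
    a ⊓ (b + c) = a ⊓ b + a ⊓ c := by
  have hb : 0 ≤ b := h.ge.trans inf_le_left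
  have hc : 0 ≤ c := h.ge.trans inf_le_right
  refine le_antisymm (inf_add_le_inf_add_inf ha hb hc) ?_
  have h' : (a ⊓ b) ⊓ (a ⊓ c) = 0 :=
    le_antisymm ((inf_le_inf inf_le_right inf_le_right).trans h.le)
      (le_inf (le_inf ha hb) (le_inf ha hc))
  rw [add_eq_sup_of_inf_eq_zero h']
  exact sup_le (inf_le_inf_left _ (le_add_of_nonneg_right hc))
    (inf_le_inf_left _ (le_add_of_nonneg_left hb))

theorem posPart_le_abs_self (x : E) : x⁺ ≤ |x| := sup_le (le_abs_self x) (abs_nonneg x)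

theorem negPart_le_abs_self (x : E) : x⁻ ≤ |x| := sup_le (neg_le_abs x) (abs_nonneg x)

/-- For disjoint summands, `(x⁺ + y⁺) - (x⁻ + y⁻)` is a difference of disjoint positive elements,
hence the decomposition of `x + y` into its positive and negative parts. -/
theorem LatticeDisjoint.posPart_add {x y : E} (h : LatticeDisjoint x y) :
    (x + y)⁺ = x⁺ + y⁺ := by
  have hx := posPart_nonneg x
  have hy := posPart_nonneg y
  have hx' := negPart_nonneg x
  have hy' := negPart_nonneg y
  have e₁ : x⁺ ⊓ y⁻ ≤ 0 := (inf_le_inf (posPart_le_abs_self x) (negPart_le_abs_self y)).trans h.le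
  have e₂ : y⁺ ⊓ x⁻ ≤ 0 :=
    (inf_le_inf (posPart_le_abs_self y) (negPart_le_abs_self x)).trans h.symm.le
  have e₃ : x⁺ ⊓ x⁻ ≤ 0 := (posPart_inf_negPart_eq_zero x).le
  have e₄ : y⁺ ⊓ y⁻ ≤ 0 := (posPart_inf_negPart_eq_zero y).le
  have key : (x⁺ + y⁺) ⊓ (x⁻ + y⁻) ≤ 0 := by
    have e₅ : x⁺ ⊓ (x⁻ + y⁻) ≤ 0 :=
      (inf_add_le_inf_add_inf hx hx' hy').trans (add_nonpos e₃ e₁)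
    have e₆ : y⁺ ⊓ (x⁻ + y⁻) ≤ 0 :=
      (inf_add_le_inf_add_inf hy hx' hy').trans (add_nonpos e₂ e₄)
    rw [inf_comm] at e₅ e₆ ⊢
    exact (inf_add_le_inf_add_inf (add_nonneg hx' hy') hx hy).trans (add_nonpos e₅ e₆)
  have key' : (x⁺ + y⁺) ⊓ (x⁻ + y⁻) = 0 :=
    le_antisymm key (le_inf (add_nonneg hx hy) (add_nonneg hx' hy'))
  have hxy : x + y + (x⁻ + y⁻) = x⁺ + y⁺ := by
    rw [add_add_add_comm, ← sub_eq_iff_eq_add.1 (posPart_sub_negPart x),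
      ← sub_eq_iff_eq_add.1 (posPart_sub_negPart y)]
  have h0 := add_eq_sup_of_inf_eq_zero key'
  rw [posPart_def]
  apply add_right_cancel (b := x⁻ + y⁻)
  rw [sup_add, hxy, zero_add, h0]

theorem LatticeDisjoint.negPart_add {x y : E} (h : LatticeDisjoint x y) :
    (x + y)⁻ = x⁻ + y⁻ := by
  rw [← posPart_neg, neg_add, h.neg.posPart_add, posPart_neg, posPart_neg]

theorem LatticeDisjoint.abs_le_abs_add {x y : E} (h : LatticeDisjoint x y) : |x| ≤ |x + y| := by
  rw [← posPart_add_negPart x, ← posPart_add_negPart (x + y), h.posPart_add, h.negPart_add]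
  exact add_le_add (le_add_of_nonneg_right (posPart_nonneg y))
    (le_add_of_nonneg_right (negPart_nonneg y))

theorem abs_commonPart_le_left (y x : E) : |commonPart y x| ≤ |y| := by
  have h₁ : 0 ≤ y⁺ ⊓ x⁺ := le_inf (posPart_nonneg y) (posPart_nonneg x)
  have h₂ : 0 ≤ y⁻ ⊓ x⁻ := le_inf (negPart_nonneg y) (negPart_nonneg x)
  refine abs_le'.2 ⟨?_, ?_⟩
  · exact (sub_le_self _ h₂).trans (inf_le_left.trans (posPart_le_abs_self y))
  · rw [commonPart, neg_sub]
    exact (sub_le_self _ h₁).trans (inf_le_left.trans (negPart_le_abs_self y))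

theorem abs_commonPart_le_right (y x : E) : |commonPart y x| ≤ |x| := by
  rw [commonPart_comm]
  exact abs_commonPart_le_left x y

theorem commonPart_add_commonPart {y z x₁ x₂ : E} (hyz : LatticeDisjoint y z)
    (hx : LatticeDisjoint x₁ x₂) (h : y + z = x₁ + x₂) :
    commonPart y x₁ + commonPart y x₂ = y := by
  have hp : x₁⁺ ⊓ x₂⁺ = 0 :=
    le_antisymm ((inf_le_inf (posPart_le_abs_self _) (posPart_le_abs_self _)).trans hx.le)
      (le_inf (posPart_nonneg _) (posPart_nonneg _))
  have hn : x₁⁻ ⊓ x₂⁻ = 0 :=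
    le_antisymm ((inf_le_inf (negPart_le_abs_self _) (negPart_le_abs_self _)).trans hx.le)
      (le_inf (negPart_nonneg _) (negPart_nonneg _))
  have e₁ : y⁺ ⊓ x₁⁺ + y⁺ ⊓ x₂⁺ = y⁺ := by
    rw [← inf_add_eq_of_inf_eq_zero (posPart_nonneg y) hp, ← hx.posPart_add, ← h,
      hyz.posPart_add]
    exact inf_eq_left.2 (le_add_of_nonneg_right (posPart_nonneg z))
  have e₂ : y⁻ ⊓ x₁⁻ + y⁻ ⊓ x₂⁻ = y⁻ := by
    rw [← inf_add_eq_of_inf_eq_zero (negPart_nonneg y) hn, ← hx.negPart_add, ← h,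
      hyz.negPart_add]
    exact inf_eq_left.2 (le_add_of_nonneg_right (negPart_nonneg z))
  rw [commonPart, commonPart, sub_add_sub_comm, e₁, e₂, posPart_sub_negPart]

/-- Two disjoint decompositions of the same element have a common disjoint refinement. -/
theorem LatticeDisjoint.exists_refinement {y z x₁ x₂ : E} (hyz : LatticeDisjoint y z)
    (hx : LatticeDisjoint x₁ x₂) (h : y + z = x₁ + x₂) :
    ∃ y₁ y₂ z₁ z₂ : E, y₁ + y₂ = y ∧ z₁ + z₂ = z ∧ y₁ + z₁ = x₁ ∧ y₂ + z₂ = x₂ ∧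
      LatticeDisjoint y₁ y₂ ∧ LatticeDisjoint z₁ z₂ ∧ LatticeDisjoint y₁ z₁ ∧
      LatticeDisjoint y₂ z₂ := by
  refine ⟨commonPart y x₁, commonPart y x₂, commonPart z x₁, commonPart z x₂,
    commonPart_add_commonPart hyz hx h,
    commonPart_add_commonPart hyz.symm hx (by rw [add_comm, h]), ?_, ?_,
    hx.mono (abs_commonPart_le_right _ _) (abs_commonPart_le_right _ _),
    hx.mono (abs_commonPart_le_right _ _) (abs_commonPart_le_right _ _),
    hyz.mono (abs_commonPart_le_left _ _) (abs_commonPart_le_left _ _),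
    hyz.mono (abs_commonPart_le_left _ _) (abs_commonPart_le_left _ _)⟩
  · rw [commonPart_comm y, commonPart_comm z]
    exact commonPart_add_commonPart hx hyz h.symm
  · rw [commonPart_comm y, commonPart_comm z]
    exact commonPart_add_commonPart hx.symm hyz (by rw [add_comm, h])

end Disjointness

/-! ### The modulus of an orthogonally additive operator -/

section Modulus

variable {E F : Type*} [Lattice E] [AddCommGroup E] [AddCommGroup F]

/-- The set of all values `T y - T z` over the disjoint decompositions `x = y + z`; its supremum is
the value at `x` of the modulus of `T`. -/
def modulusSet (T : E → F) (x : E) : Set F :=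
  {w | ∃ y z : E, LatticeDisjoint y z ∧ y + z = x ∧ w = T y - T z}

theorem modulusSet_nonempty [IsOrderedAddMonoid E] (T : E → F) (x : E) :
    (modulusSet T x).Nonempty :=
  ⟨_, x, 0, latticeDisjoint_zero_right x, add_zero x, rfl⟩

variable [Module ℝ F] [IsOrderedAddMonoid E]

theorem OrthogonallyAdditive.map_zero (T : OrthogonallyAdditive E F) :
    (T : E → F) 0 = 0 := by
  simpa using T.2 0 0 (latticeDisjoint_zero_right (0 : E))

open Pointwise in
theorem OrthogonallyAdditive.modulusSet_add (T : OrthogonallyAdditive E F) {x₁ x₂ : E}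
    (hx : LatticeDisjoint x₁ x₂) :
    modulusSet (T : E → F) (x₁ + x₂) = modulusSet (T : E → F) x₁ + modulusSet (T : E → F) x₂ := by
  ext w
  rw [Set.mem_add]
  constructor
  · rintro ⟨y, z, hyz, h, rfl⟩
    obtain ⟨y₁, y₂, z₁, z₂, rfl, rfl, h₁, h₂, hy, hz, d₁, d₂⟩ := hyz.exists_refinement hx h
    refine ⟨_, ⟨y₁, z₁, d₁, h₁, rfl⟩, _, ⟨y₂, z₂, d₂, h₂, rfl⟩, ?_⟩
    rw [T.2 _ _ hy, T.2 _ _ hz]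
    abel
  · rintro ⟨_, ⟨y₁, z₁, d₁, rfl, rfl⟩, _, ⟨y₂, z₂, d₂, rfl, rfl⟩, rfl⟩
    have hy₁ := d₁.abs_le_abs_add
    have hy₂ := d₂.abs_le_abs_add
    have hz₁ : |z₁| ≤ |y₁ + z₁| := by rw [add_comm]; exact d₁.symm.abs_le_abs_add
    have hz₂ : |z₂| ≤ |y₂ + z₂| := by rw [add_comm]; exact d₂.symm.abs_le_abs_add
    refine ⟨y₁ + y₂, z₁ + z₂, ?_, add_add_add_comm _ _ _ _, ?_⟩
    · exact (d₁.add_right (hx.mono hy₁ hz₂)).add_left ((hx.symm.mono hy₂ hz₁).add_right d₂)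
    · rw [T.2 _ _ (hx.mono hy₁ hy₂), T.2 _ _ (hx.mono hz₁ hz₂)]
      abel

theorem OrthogonallyAdditive.isModulus_of_isLUB [Lattice F] [IsOrderedAddMonoid F]
    {T R : OrthogonallyAdditive E F}
    (hR : ∀ x, IsLUB (modulusSet (T : E → F) x) ((R : E → F) x)) : IsModulus T R := by
  constructor
  · rintro S (rfl | rfl) x
    · exact (hR x).1 ⟨x, 0, latticeDisjoint_zero_right x, add_zero x, by
        simp [OrthogonallyAdditive.map_zero]⟩
    · exact (hR x).1 ⟨0, x, (latticeDisjoint_zero_right x).symm, zero_add x, by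
        simp [OrthogonallyAdditive.map_zero]⟩
  · intro S hS x
    refine (hR x).2 ?_
    rintro _ ⟨y, z, hyz, rfl, rfl⟩
    have h₁ : (T : E → F) y ≤ (S : E → F) y := hS (Or.inl rfl) y
    have h₂ : -(T : E → F) z ≤ (S : E → F) z := hS (Or.inr rfl) z
    rw [S.2 _ _ hyz, sub_eq_add_neg]
    exact add_le_add h₁ h₂

end Modulus

/-- Fragments of the elements of a bounded set are bounded, so a compact `T` keeps all the sets
`modulusSet T x` with `x` in a bounded set inside one totally bounded set. -/
theorem MapsBoundedToRelCompact.exists_totallyBounded {E F : Type*} [NormedAddCommGroup E]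
    [Lattice E] [IsOrderedAddMonoid E] [HasSolidNorm E] [NormedAddCommGroup F] {T : E → F}
    (hT : MapsBoundedToRelCompact T) {B : Set E} (hB : Bornology.IsBounded B) :
    ∃ G : Set F, TotallyBounded G ∧ ∀ x ∈ B, modulusSet T x ⊆ G := by
  obtain ⟨r, hr⟩ := hB.exists_norm_le
  have hK := hT (Metric.closedBall 0 r) Metric.isBounded_closedBall
  refine ⟨_, ((hK.prod hK).image continuous_sub).totallyBounded, ?_⟩
  rintro x hx _ ⟨y, z, hyz, rfl, rfl⟩
  have mem : ∀ w : E, |w| ≤ |y + z| → T w ∈ closure (T '' Metric.closedBall 0 r) := fun w hw =>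
    subset_closure ⟨w, mem_closedBall_zero_iff.2
      ((norm_le_norm_of_abs_le_abs hw).trans (hr _ hx)), rfl⟩
  refine ⟨(T y, T z), ⟨mem y hyz.abs_le_abs_add, mem z ?_⟩, rfl⟩
  rw [add_comm]
  exact hyz.symm.abs_le_abs_add

theorem theorem3p11
    -- `E` is a Banach lattice
    {E : Type*} [NormedAddCommGroup E] [NormedSpace ℝ E] [CompleteSpace E]
    [Lattice E] [IsOrderedAddMonoid E] [IsOrderedModule ℝ E] [HasSolidNorm E]
    -- `F` is an AM-space
    {F : Type*} [NormedAddCommGroup F] [NormedSpace ℝ F] [CompleteSpace F]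
    [Lattice F] [IsOrderedAddMonoid F] [IsOrderedModule ℝ F] [HasSolidNorm F]
    (hF : IsMNorm F)
    (T : OrthogonallyAdditive E F) (hT : MapsBoundedToRelCompact (T : E → F)) :
    ∃ R : OrthogonallyAdditive E F,
      IsModulus T R ∧ MapsBoundedToRelCompact (R : E → F) := by
  have hex : ∀ x, ∃ w, IsLUB (modulusSet (T : E → F) x) w := by
    intro x
    obtain ⟨G, hG, hxG⟩ := hT.exists_totallyBounded (Bornology.isBounded_singleton (x := x))
    obtain ⟨w, hw, -⟩ := hF.exists_isLUB_of_totallyBounded (hG.subset (hxG x rfl))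
      (modulusSet_nonempty (T : E → F) x)
    exact ⟨w, hw⟩
  choose R hR using hex
  have hRadd : R ∈ OrthogonallyAdditive E F := by
    intro x y hxy
    have h := (hR x).add (hR y)
    rw [← OrthogonallyAdditive.modulusSet_add T hxy] at h
    exact (hR (x + y)).unique h
  refine ⟨⟨R, hRadd⟩, OrthogonallyAdditive.isModulus_of_isLUB hR, fun B hB => ?_⟩
  obtain ⟨G, hG, hBG⟩ := hT.exists_totallyBounded hB
  have hRB : TotallyBounded (R '' B) := by
    refine (hF.totallyBounded_setOf_isLUB hG).subset ?_
    rintro _ ⟨x, hx, rfl⟩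
    exact ⟨_, hBG x hx, modulusSet_nonempty (T : E → F) x, hR x⟩
  exact hRB.closure.isCompact_of_isClosed isClosed_closure
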